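/- An arc in a topological space $X$ is a subspace $\gamma\subseteq X$ homeomorphic to $[0,1]$; its end points are the images of $0$ and $1$. Points $x,y$ can be joined by an arc in $S\subseteq X$ if $x=y\in S$ (degenerate arc) or there is an arc $\gamma\subseteq S$ with end points $x$ and $y$; sets $A,B\subseteq X$ can be joined by an arc in $S$ if some $a\in A$ and some $b\in B$ can be joined by an arc in $S$. The space $X$ is called almost arcwise connected if any two nonempty open subsets of $X$ can be joined by an arc in $X$. It is called locally almost arcwise connected if for every $x\in X$ and every neighborhood $V$ of $x$ there is a neighborhood $U\subseteq V$ of $x$ such that any two nonempty open subsets of $X$ contained in $U$ can be joined by an arc in $\overline{V}$. Lemma. Let $X$ be a completely metrizable space that is almost arcwise connected and locally almost arcwise connected. Then $X$ is arcwise connected (any two points of $X$ can be joined by an arc in $X$) and locally arcwise connected (for every $x\in X$ and every neighborhood $V$ of $x$ there is an open set $U$ with $x\in U\subseteq V$ such that any two points of $U$ can be joined by an arc in $U$). -/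

import Mathlib

open Set Topology

/-- The points `x` and `y` can be joined by an arc in the set `S`: some homeomorphic copy of the
unit interval with end points `x` and `y` lies in `S`. As usual, a point of `S` is regarded as
joined to itself by a degenerate arc. -/
def ArcJoinedIn {X : Type*} [TopologicalSpace X] (S : Set X) (x y : X) : Prop :=
  (x = y ∧ x ∈ S) ∨ ∃ γ : Path x y, IsEmbedding (γ : unitInterval → X) ∧ range γ ⊆ S

/-- The sets `A` and `B` can be joined by an arc in `S`: some point of `A` and some point of `B`
can be joined by an arc in `S`. -/
def SetsArcJoinedIn {X : Type*} [TopologicalSpace X] (S A B : Set X) : Prop :=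
  ∃ a ∈ A, ∃ b ∈ B, ArcJoinedIn S a b

/-- Each pair of nonempty open subsets of `X` can be joined by an arc in `X`. -/
def AlmostArcwiseConnected (X : Type*) [TopologicalSpace X] : Prop :=
  ∀ A B : Set X, IsOpen A → A.Nonempty → IsOpen B → B.Nonempty → SetsArcJoinedIn univ A B

/-- For any neighborhood `V` of `x` there is a neighborhood `U ⊆ V` of `x` such that each pair of
nonempty open subsets of `U` can be joined by an arc in the closure of `V`. -/
def LocallyAlmostArcwiseConnectedAt {X : Type*} [TopologicalSpace X] (x : X) : Prop :=
  ∀ V ∈ 𝓝 x, ∃ U ∈ 𝓝 x, U ⊆ V ∧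
    ∀ A B : Set X, IsOpen A → A.Nonempty → A ⊆ U → IsOpen B → B.Nonempty → B ⊆ U →
      SetsArcJoinedIn (closure V) A B

/-- `X` is locally almost arcwise connected at every point. -/
def LocallyAlmostArcwiseConnected (X : Type*) [TopologicalSpace X] : Prop :=
  ∀ x : X, LocallyAlmostArcwiseConnectedAt x

/-- Any two points of the set `S` can be joined by an arc in `S`. -/
def IsArcwiseConnected {X : Type*} [TopologicalSpace X] (S : Set X) : Prop :=
  ∀ x ∈ S, ∀ y ∈ S, ArcJoinedIn S x y

/-- Any two points of `X` can be joined by an arc in `X`. -/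
def ArcwiseConnected (X : Type*) [TopologicalSpace X] : Prop :=
  IsArcwiseConnected (univ : Set X)

/-- Every point of `X` has a neighborhood base of arcwise connected open sets. -/
def LocallyArcwiseConnected (X : Type*) [TopologicalSpace X] : Prop :=
  ∀ x : X, ∀ V ∈ 𝓝 x, ∃ U : Set X, IsOpen U ∧ x ∈ U ∧ U ⊆ V ∧ IsArcwiseConnected U

/-! Fix a complete metric. Local almost arcwise connectedness gives each point, at scale `2⁻ⁿ`, a
neighborhood in which nearby `p` and `q` are joined by a small path up to two gaps, one at `p` and
one at `q`, each of scale `2⁻⁽ⁿ⁺¹⁾`. Filling the gaps again and again and bridging the remaining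
ones by segments in an ambient Banach space gives a uniformly Cauchy sequence of paths, whose limit
lies in `X` by completeness (`GapFilling.joinedIn`). Thus points near `x` are joined to `x` by small
paths, and both conclusions follow for paths. Paths become arcs by `JoinedIn.arcJoinedIn`: loops are
cut out along a minimal closed parameter set, which leaves a path with order connected fibres, and
the intervals of constancy are then collapsed. -/

/-! ### Collapsing intervals of constancy -/

/-- A map of the unit interval whose fibres are order connected, running between distinct points
of a metric space, factors through a monotone reparametrization with the same fibres. -/
theorem exists_surjective_same_fibers {X : Type*} [MetricSpace X] (g : C(unitInterval, X))
    (hg : ∀ s t u, g s = g t → s ≤ u → u ≤ t → g u = g s) (h01 : g 0 ≠ g 1) :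
    ∃ H : C(unitInterval, unitInterval), Function.Surjective H ∧ H 0 = 0 ∧ H 1 = 1 ∧
      ∀ s t, H s = H t ↔ g s = g t := by
  -- `v` is clamped to `[s, t]`, so `M s t` is the largest distance from `g s` reached on `[s, t]`;
  -- it is `0` when `t ≤ s`.
  let F : unitInterval → unitInterval → unitInterval → ℝ :=
    fun s t v => dist (g (max s (min v t))) (g s)
  let M : unitInterval → unitInterval → ℝ := fun s t => sSup (F s t '' univ)
  obtain ⟨D, hD⟩ : ∃ D, ∀ a b, dist (g a) (g b) ≤ D := by
    obtain ⟨D, hD⟩ := Metric.isBounded_iff.1 (isCompact_range g.continuous).isBounded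
    exact ⟨D, fun a b => hD (mem_range_self a) (mem_range_self b)⟩
  have hbdd : ∀ s t, BddAbove (F s t '' univ) := by
    rintro s t
    exact ⟨D, by rintro _ ⟨v, -, rfl⟩; exact hD _ _⟩
  have hM0 : ∀ s t, 0 ≤ M s t := fun s t =>
    Real.sSup_nonneg (by rintro _ ⟨v, -, rfl⟩; exact dist_nonneg)
  have hMD : ∀ s t, M s t ≤ D := fun s t =>
    csSup_le (univ_nonempty.image _) (by rintro _ ⟨v, -, rfl⟩; exact hD _ _)
  have hMc : ∀ s, Continuous (M s) := fun s =>
    isCompact_univ.continuous_sSup (f := F s) (by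
      change Continuous fun p : unitInterval × unitInterval =>
        dist (g (max s (min p.2 p.1))) (g s)
      fun_prop)
  have hMmono : ∀ s, Monotone (M s) := fun s t t' htt => by
    refine csSup_le_csSup (hbdd s t') (univ_nonempty.image _) ?_
    rintro _ ⟨v, -, rfl⟩
    exact ⟨min v t, mem_univ _, by simp only [F]; rw [min_eq_left ((min_le_right v t).trans htt)]⟩
  have hMz : ∀ s t, t ≤ s → M s t = 0 := fun s t hts => by
    have : F s t = fun _ => 0 := by
      funext v
      simp only [F]
      rw [max_eq_left ((min_le_right v t).trans hts), dist_self]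
    simp only [M, this]
    simp
  have hMeq : ∀ s a b, a ≤ b → g a = g b → M s a = M s b := fun s a b hab hgab => by
    have : F s a = F s b := by
      funext v
      simp only [F]
      congr 1
      rcases le_total v a with hva | hva
      · rw [min_eq_left hva, min_eq_left (hva.trans hab)]
      rw [min_eq_right hva]
      have h1 : a ≤ min v b := le_min hva hab
      rcases le_total s (min v b) with hs | hs
      · rw [max_eq_right hs, hg a b _ hgab (le_max_right s a)
          (max_le (hs.trans (min_le_right _ _)) hab), hg a b _ hgab h1 (min_le_right _ _)]
      · rw [max_eq_left hs, max_eq_left (h1.trans hs)]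
    simp only [M, this]
  -- A weighted sum of the `M (q n)` over a dense sequence of base points is continuous and
  -- monotone, and grows exactly when `g` changes.
  let q := TopologicalSpace.denseSeq unitInterval
  let w : ℕ → unitInterval → ℝ := fun n t => (1 / 2) ^ n * M (q n) t
  have hw : ∀ n t, ‖w n t‖ ≤ (1 / 2) ^ n * D := fun n t => by
    have := hM0 (q n) t
    rw [Real.norm_of_nonneg (by positivity)]
    exact mul_le_mul_of_nonneg_left (hMD _ _) (by positivity)
  have hsum : Summable fun n : ℕ => (1 / 2 : ℝ) ^ n * D :=
    summable_geometric_two.mul_right D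
  have hws : ∀ t, Summable fun n => w n t := fun t =>
    Summable.of_norm_bounded hsum fun n => hw n t
  let h : unitInterval → ℝ := fun t => ∑' n, w n t
  have hc : Continuous h :=
    continuous_tsum (fun n => (hMc (q n)).const_mul _) hsum hw
  have hwmono : ∀ n, Monotone (w n) := fun n a b hab =>
    mul_le_mul_of_nonneg_left (hMmono _ hab) (by positivity)
  have hmono : Monotone h := fun a b hab =>
    (hws a).tsum_le_tsum (fun n => hwmono n hab) (hws b)
  have heq : ∀ a b, a ≤ b → g a = g b → h a = h b := fun a b hab hgab => by
    simp only [h, w, hMeq _ a b hab hgab]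
  have hlt : ∀ a b, a ≤ b → g a ≠ g b → h a < h b := fun a b hab hgab => by
    have hab' : a < b := lt_of_le_of_ne hab fun e => hgab (by rw [e])
    -- A base point `q n` just to the right of `a` still has `g (q n) ≠ g b`; its term vanishes at
    -- `a` and is positive at `b`.
    have hO : IsOpen {u | g u ≠ g b} := isOpen_ne_fun g.continuous continuous_const
    obtain ⟨c, hac, hcO⟩ : ∃ c, a < c ∧ Ico a c ⊆ {u | g u ≠ g b} :=
      exists_Ico_subset_of_mem_nhds (hO.mem_nhds hgab) ⟨b, hab'⟩
    obtain ⟨u, hu⟩ := exists_between (lt_min hac hab')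
    obtain ⟨n, hn⟩ := (TopologicalSpace.denseRange_denseSeq unitInterval).exists_mem_open
      (isOpen_Ioo (a := a) (b := min c b)) ⟨u, hu⟩
    change q n ∈ _ at hn
    have hqb : q n ≤ b := hn.2.le.trans (min_le_right _ _)
    have hne : g (q n) ≠ g b := hcO ⟨hn.1.le, hn.2.trans_le (min_le_left _ _)⟩
    have hpos : 0 < M (q n) b := by
      refine lt_of_lt_of_le (dist_pos.2 hne.symm) (le_csSup (hbdd _ _) ⟨b, mem_univ _, ?_⟩)
      simp only [F, min_self, max_eq_right hqb]
    refine Summable.tsum_lt_tsum (i := n) (fun n => hwmono n hab) ?_ (hws a) (hws b)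
    simp only [w, hMz _ _ hn.1.le]
    exact mul_lt_mul_of_pos_left hpos (by positivity)
  have h0 : h 0 = 0 := by
    simp [h, w, hMz _ _ (unitInterval.nonneg' (t := _))]
  have h1 : 0 < h 1 := h0 ▸ hlt 0 1 unitInterval.nonneg' h01
  have hmem : ∀ t, h t / h 1 ∈ Icc (0 : ℝ) 1 := fun t =>
    ⟨div_nonneg (h0 ▸ hmono unitInterval.nonneg') h1.le,
      (div_le_one h1).2 (hmono unitInterval.le_one')⟩
  refine ⟨⟨fun t => ⟨h t / h 1, hmem t⟩, by fun_prop⟩, ?_, ?_, ?_, ?_⟩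
  · intro y
    have hy : (y : ℝ) * h 1 ∈ Icc (h 0) (h 1) := by
      rw [h0]
      exact ⟨mul_nonneg y.2.1 h1.le, mul_le_of_le_one_left h1.le y.2.2⟩
    obtain ⟨t, ht⟩ := mem_range_of_exists_le_of_exists_ge hc ⟨0, hy.1⟩ ⟨1, hy.2⟩
    exact ⟨t, Subtype.ext (by simp [ht, h1.ne'])⟩
  · exact Subtype.ext (by simp [h0])
  · exact Subtype.ext (by simp [h1.ne'])
  · intro s t
    have key : h s = h t ↔ g s = g t := by
      rcases le_total s t with hst | hst
      · exact ⟨fun e => by_contra fun hne => (hlt s t hst hne).ne e, heq s t hst⟩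
      · exact ⟨fun e => by_contra fun hne => (hlt t s hst (Ne.symm hne)).ne e.symm,
          fun e => (heq t s hst e.symm).symm⟩
    rw [← key]
    simp [Subtype.ext_iff, div_left_inj' h1.ne']

/-! ### Cutting loops out of a path -/

/-- A closed set of parameters, containing both end points, across each of whose gaps `f` takes
equal values. -/
structure IsGapSet {X : Type*} [TopologicalSpace X] (f : C(unitInterval, X))
    (K : Set unitInterval) : Prop where
  isClosed : IsClosed K
  zero_mem : 0 ∈ K
  one_mem : 1 ∈ K
  eq_of_gap : ∀ a ∈ K, ∀ b ∈ K, a < b → Disjoint (Ioo a b) K → f a = f b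

theorem exists_isGreatest_inter_Iic {K : Set unitInterval} (hK : IsClosed K) (h0 : 0 ∈ K)
    (t : unitInterval) : ∃ p, IsGreatest (K ∩ Iic t) p :=
  (hK.inter isClosed_Iic).isCompact.exists_isGreatest ⟨0, h0, unitInterval.nonneg'⟩

theorem exists_isLeast_inter_Ici {K : Set unitInterval} (hK : IsClosed K) (h1 : 1 ∈ K)
    (t : unitInterval) : ∃ p, IsLeast (K ∩ Ici t) p :=
  (hK.inter isClosed_Ici).isCompact.exists_isLeast ⟨1, h1, unitInterval.le_one'⟩

/-- If `f a ≠ f b` across a gap of the intersection, separate the two values by open sets. By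
compactness, some member of the chain already misses a slightly smaller `[a', b']`; the end points
of its gap around `[a', b']` have equal values, yet these lie in the disjoint open sets. -/
theorem IsGapSet.sInter {X : Type*} [TopologicalSpace X] [T2Space X] {f : C(unitInterval, X)}
    {c : Set (Set unitInterval)} (hc : ∀ K ∈ c, IsGapSet f K) (hchain : IsChain (· ⊆ ·) c)
    (hne : c.Nonempty) : IsGapSet f (⋂₀ c) := by
  refine ⟨isClosed_sInter fun K hK => (hc K hK).isClosed, fun K hK => (hc K hK).zero_mem,
    fun K hK => (hc K hK).one_mem, fun a ha b hb hab hdisj => ?_⟩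
  by_contra hfab
  obtain ⟨U, V, hU, hV, haU, hbV, hUV⟩ := t2_separation hfab
  obtain ⟨m, ham, hmb⟩ := exists_between hab
  obtain ⟨a₁, ha₁, ha₁U⟩ := exists_Ico_subset_of_mem_nhds
    ((hU.preimage f.continuous).mem_nhds haU) ⟨m, ham⟩
  obtain ⟨b₁, hb₁, hb₁V⟩ := exists_Ioc_subset_of_mem_nhds
    ((hV.preimage f.continuous).mem_nhds hbV) ⟨m, hmb⟩
  obtain ⟨a', haa', ha'⟩ := exists_between (lt_min ha₁ ham)
  obtain ⟨b', hb', hbb'⟩ := exists_between (max_lt hb₁ hmb)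
  have ha'm : a' < m := ha'.trans_le (min_le_right _ _)
  have hmb' : m < b' := (le_max_right _ _).trans_lt hb'
  have : Nonempty c := hne.to_subtype
  obtain ⟨K, hK⟩ := (isCompact_Icc (a := a') (b := b')).elim_directed_family_closed
    (fun K : c => (K : Set unitInterval)) (fun K => (hc K K.2).isClosed) (by
      rw [← sInter_eq_iInter, ← disjoint_iff_inter_eq_empty]
      exact hdisj.mono_left (Icc_subset_Ioo haa' hbb'))
    (fun K L => (hchain.total K.2 L.2).elim (fun h => ⟨K, Subset.rfl, h⟩)
      fun h => ⟨L, h, Subset.rfl⟩)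
  have hKg := hc K K.2
  obtain ⟨p, hp, hp'⟩ := exists_isGreatest_inter_Iic hKg.isClosed hKg.zero_mem a'
  obtain ⟨r, hr, hr'⟩ := exists_isLeast_inter_Ici hKg.isClosed hKg.one_mem b'
  have hap : a ≤ p := hp' ⟨ha K K.2, haa'.le⟩
  have hrb : r ≤ b := hr' ⟨hb K K.2, hbb'.le⟩
  have hfpr : f p = f r := by
    refine hKg.eq_of_gap p hp.1 r hr.1 (hp.2.trans_lt (ha'm.trans (hmb'.trans_le hr.2))) ?_
    rw [Set.disjoint_left]
    intro z hz hzK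
    rcases le_or_gt z a' with hza | hza
    · exact (hp' ⟨hzK, hza⟩).not_gt hz.1
    rcases le_or_gt b' z with hzb | hzb
    · exact (hr' ⟨hzK, hzb⟩).not_gt hz.2
    exact (hK.subset ⟨⟨hza.le, hzb.le⟩, hzK⟩ : z ∈ (∅ : Set unitInterval))
  refine (fun hpU hpV => Set.disjoint_left.1 hUV hpU hpV : f p ∈ U → f p ∉ V)
    (ha₁U ⟨hap, hp.2.trans_lt (ha'.trans_le (min_le_left _ _))⟩) ?_
  rw [hfpr]
  exact hb₁V ⟨(le_max_left _ _).trans_lt (hb'.trans_le hr.2), hrb⟩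

/-- Zorn's lemma gives a minimal gap set. If it met `Ioo s t` with `f s = f t`, deleting `Ioo s t`
would leave a smaller gap set: the only new gap is `Ioo s t` itself. -/
theorem exists_minimal_isGapSet {X : Type*} [TopologicalSpace X] [T2Space X]
    (f : C(unitInterval, X)) : ∃ K, IsGapSet f K ∧
      ∀ s ∈ K, ∀ t ∈ K, s < t → f s = f t → Disjoint (Ioo s t) K := by
  obtain ⟨K, -, hK⟩ := zorn_superset_nonempty {K | IsGapSet f K}
    (fun c hc hchain hne =>
      ⟨⋂₀ c, IsGapSet.sInter hc hchain hne, fun s hs => sInter_subset_of_mem hs⟩)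
    univ ⟨isClosed_univ, mem_univ _, mem_univ _, fun a _ b _ hab hd => by
      obtain ⟨m, hm⟩ := exists_between hab
      exact absurd (mem_univ m) (Set.disjoint_left.1 hd hm)⟩
  have hg : IsGapSet f K := hK.prop
  refine ⟨K, hg, fun s hs t ht hst hfst => ?_⟩
  have hmem : IsGapSet f (K \ Ioo s t) := by
    refine ⟨hg.isClosed.sdiff isOpen_Ioo, ⟨hg.zero_mem, fun h => h.1.not_ge unitInterval.nonneg'⟩,
      ⟨hg.one_mem, fun h => h.2.not_ge unitInterval.le_one'⟩, fun a ha b hb hab hd => ?_⟩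
    by_cases hd' : Disjoint (Ioo a b) K
    · exact hg.eq_of_gap a ha.1 b hb.1 hab hd'
    obtain ⟨u, hu, huK⟩ := Set.not_disjoint_iff.1 hd'
    have hust : u ∈ Ioo s t := by_contra fun h => Set.disjoint_left.1 hd hu ⟨huK, h⟩
    have has : a ≤ s := not_lt.1 fun h => ha.2 ⟨h, hu.1.trans hust.2⟩
    have htb : t ≤ b := not_lt.1 fun h => hb.2 ⟨hust.1.trans hu.2, h⟩
    have hsa : s ≤ a := not_lt.1 fun h => Set.disjoint_left.1 hd
      ⟨h, hst.trans_le htb⟩ ⟨hs, fun h => lt_irrefl _ h.1⟩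
    have hbt : b ≤ t := not_lt.1 fun h => Set.disjoint_left.1 hd
      ⟨has.trans_lt hst, h⟩ ⟨ht, fun h => lt_irrefl _ h.2⟩
    rw [le_antisymm has hsa, le_antisymm hbt htb, hfst]
  exact Set.disjoint_left.2 fun z hz hzK => (hK.le_of_le hmem sdiff_subset hzK).2 hz

/-- Cutting out loops: a path can be replaced by one with order connected fibres. -/
theorem exists_ordConnected_fibers {X : Type*} [TopologicalSpace X] [T2Space X]
    (f : C(unitInterval, X)) : ∃ g : C(unitInterval, X), g 0 = f 0 ∧ g 1 = f 1 ∧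
      range g ⊆ range f ∧ ∀ s t u, g s = g t → s ≤ u → u ≤ t → g u = g s := by
  obtain ⟨K, hK, hmin⟩ := exists_minimal_isGapSet f
  -- The loop-free path is `f ∘ l`: it stays constant across each gap of `K`.
  choose l hl hl' using exists_isGreatest_inter_Iic hK.isClosed hK.zero_mem
  choose r hr hr' using exists_isLeast_inter_Ici hK.isClosed hK.one_mem
  have hlK : ∀ t ∈ K, l t = t := fun t ht => le_antisymm (hl t).2 (hl' t ⟨ht, le_refl t⟩)
  have hlr : ∀ t, f (l t) = f (r t) := fun t => by
    rcases ((mem_Iic.1 (hl t).2).trans (mem_Ici.1 (hr t).2)).eq_or_lt with e | hlt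
    · rw [e]
    refine hK.eq_of_gap _ (hl t).1 _ (hr t).1 hlt (Set.disjoint_left.2 fun z hz hzK => ?_)
    rcases le_total z t with h | h
    · exact (hl' t ⟨hzK, h⟩).not_gt hz.1
    · exact (hr' t ⟨hzK, h⟩).not_gt hz.2
  have hmono : Monotone l := fun s t hst => hl' t ⟨(hl s).1, (hl s).2.trans hst⟩
  have hcont : Continuous fun t => f (l t) := by
    refine continuous_iff_continuousAt.2 fun t => ?_
    by_cases ht : t ∈ K
    -- If a gap of `K` ends at `t`, then `l` jumps there. Using `r` instead to the left of `t`
    -- leaves the values of `f` unchanged and squeezes the parameter towards `t`.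
    · let m : unitInterval → unitInterval := fun s => if t ≤ s then l s else r s
      have hm : ∀ s, f (l s) = f (m s) := fun s => by
        by_cases h : t ≤ s
        · simp [m, h]
        · simp [m, h, hlr]
      have hlow : ∀ s, min s t ≤ m s := fun s => by
        by_cases h : t ≤ s
        · simp only [m, h, if_true]
          exact (min_le_right _ _).trans (hl' s ⟨ht, h⟩)
        · simp only [m, h, if_false]
          exact (min_le_left _ _).trans (hr s).2
      have hupp : ∀ s, m s ≤ max s t := fun s => by
        by_cases h : t ≤ s
        · simp only [m, h, if_true]
          exact (hl s).2.trans (le_max_left _ _)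
        · simp only [m, h, if_false]
          exact (hr' s ⟨ht, (not_le.1 h).le⟩).trans (le_max_right _ _)
      have hmt : Filter.Tendsto m (𝓝 t) (𝓝 t) := by
        refine tendsto_of_tendsto_of_tendsto_of_le_of_le ?_ ?_ hlow hupp
        · have : Continuous fun s : unitInterval => min s t := by fun_prop
          simpa using this.tendsto t
        · have : Continuous fun s : unitInterval => max s t := by fun_prop
          simpa using this.tendsto t
      rw [ContinuousAt, hlK t ht]
      simp only [hm]
      exact (f.continuous.tendsto t).comp hmt
    -- Inside a gap `l` is locally constant.
    · have hlt : l t < t := lt_of_le_of_ne (hl t).2 fun e => ht (e ▸ (hl t).1)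
      have htr : t < r t := lt_of_le_of_ne (hr t).2 fun e => ht (e ▸ (hr t).1)
      refine (continuousAt_const (y := f (l t))).congr ?_
      filter_upwards [Ioo_mem_nhds hlt htr] with s hs
      congr 1
      refine le_antisymm (hl' s ⟨(hl t).1, hs.1.le⟩) (hl' t ⟨(hl s).1, mem_Iic.2 (not_lt.1 fun h => ?_)⟩)
      exact (hr' t ⟨(hl s).1, h.le⟩).not_gt ((hl s).2.trans_lt hs.2)
  refine ⟨⟨fun t => f (l t), hcont⟩, ?_, ?_, ?_, fun s t u hst hsu hut => ?_⟩
  · simp [hlK 0 hK.zero_mem]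
  · simp [hlK 1 hK.one_mem]
  · rintro _ ⟨t, rfl⟩
    exact mem_range_self (l t)
  · change f (l s) = f (l t) at hst
    change f (l u) = f (l s)
    rcases (hmono hsu).eq_or_lt with e | h1
    · rw [e]
    rcases (hmono hut).eq_or_lt with e | h2
    · rw [e, hst]
    exact absurd (hl u).1 (Set.disjoint_left.1
      (hmin _ (hl s).1 _ (hl t).1 (h1.trans h2) hst) ⟨h1, h2⟩)

/-- Points of a metric space that are joined by a path are joined by an arc. -/
theorem JoinedIn.arcJoinedIn {X : Type*} [MetricSpace X] {S : Set X} {x y : X}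
    (h : JoinedIn S x y) : ArcJoinedIn S x y := by
  by_cases hxy : x = y
  · exact Or.inl ⟨hxy, h.source_mem⟩
  obtain ⟨f, hf⟩ := h
  obtain ⟨g, hg0, hg1, hgr, hg⟩ := exists_ordConnected_fibers f.toContinuousMap
  have hg0 : g 0 = x := by simpa using hg0
  have hg1 : g 1 = y := by simpa using hg1
  obtain ⟨H, hHs, hH0, hH1, hH⟩ := exists_surjective_same_fibers g hg (by rwa [hg0, hg1])
  -- Since `H` and `g` have the same fibres, `g` descends along `H` to an injective map, which is an
  -- embedding by compactness.
  have hq : IsQuotientMap H := H.continuous.isClosedMap.isQuotientMap H.continuous hHs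
  let γ : C(unitInterval, X) := hq.lift g fun a b e => (hH a b).1 e
  have hγ : ∀ t, γ (H t) = g t := fun t =>
    DFunLike.congr_fun (hq.lift_comp g fun a b e => (hH a b).1 e) t
  have hinj : Function.Injective γ := fun a b hab => by
    obtain ⟨s, rfl⟩ := hHs a
    obtain ⟨t, rfl⟩ := hHs b
    rwa [hH, ← hγ, ← hγ]
  refine Or.inr ⟨⟨γ, ?_, ?_⟩, (γ.continuous.isClosedEmbedding hinj).isEmbedding, ?_⟩
  · change γ 0 = x
    rw [← hH0, hγ, hg0]
  · change γ 1 = y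
    rw [← hH1, hγ, hg1]
  · rintro _ ⟨a, rfl⟩
    obtain ⟨s, rfl⟩ := hHs a
    change γ (H s) ∈ S
    rw [hγ]
    obtain ⟨u, hu⟩ := hgr (mem_range_self s)
    rw [← hu]
    exact hf u

/-! ### Ambient normed space and path estimates -/

/-- The Kuratowski embedding of a metric space into its bounded continuous functions. -/
theorem exists_isometry_boundedContinuousFunction (X : Type*) [MetricSpace X] [Nonempty X] :
    ∃ ι : X → BoundedContinuousFunction X ℝ, Isometry ι := by
  obtain ⟨o⟩ := ‹Nonempty X›
  -- Subtracting `dist o z` makes the function of `z` bounded; it cancels in differences.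
  let ι : X → BoundedContinuousFunction X ℝ := fun x =>
    BoundedContinuousFunction.ofNormedAddCommGroup (fun z => dist x z - dist o z) (by fun_prop)
      (dist x o) fun z => abs_dist_sub_le x o z
  refine ⟨ι, Isometry.of_dist_eq fun x y => le_antisymm ?_ ?_⟩
  · refine (BoundedContinuousFunction.dist_le dist_nonneg).2 fun z => ?_
    change dist (dist x z - dist o z) (dist y z - dist o z) ≤ _
    rw [Real.dist_eq, sub_sub_sub_cancel_right]
    exact abs_dist_sub_le x y z
  · have h := BoundedContinuousFunction.dist_coe_le_dist (f := ι x) (g := ι y) y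
    change dist (dist x y - dist o y) (dist y y - dist o y) ≤ _ at h
    rwa [Real.dist_eq, sub_sub_sub_cancel_right, dist_self, sub_zero, abs_dist] at h

theorem Path.forall_trans {E : Type*} [TopologicalSpace E] {a b c : E} {P : E → Prop}
    {γ : Path a b} {γ' : Path b c} (h : ∀ t, P (γ t)) (h' : ∀ t, P (γ' t)) (t : unitInterval) :
    P (γ.trans γ' t) := by
  rw [Path.trans_apply]
  split_ifs
  exacts [h _, h' _]

theorem Path.dist_trans_le {E : Type*} [PseudoMetricSpace E] {a b c : E} {C : ℝ}
    {γ δ : Path a b} {γ' δ' : Path b c} (h : ∀ t, dist (γ t) (δ t) ≤ C)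
    (h' : ∀ t, dist (γ' t) (δ' t) ≤ C) (t : unitInterval) :
    dist (γ.trans γ' t) (δ.trans δ' t) ≤ C := by
  rw [Path.trans_apply, Path.trans_apply]
  split_ifs
  exacts [h _, h' _]

/-- The straight segment as a path. -/
def segmentPath {E : Type*} [NormedAddCommGroup E] [NormedSpace ℝ E] (a b : E) : Path a b where
  toFun t := AffineMap.lineMap a b (t : ℝ)
  continuous_toFun := by fun_prop
  source' := by simp
  target' := by simp

theorem dist_segmentPath_le {E : Type*} [NormedAddCommGroup E] [NormedSpace ℝ E] (a b : E)
    (t : unitInterval) : dist (segmentPath a b t) a ≤ dist a b := by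
  change dist (AffineMap.lineMap a b (t : ℝ)) a ≤ _
  rw [dist_lineMap_left, Real.norm_of_nonneg t.2.1]
  exact mul_le_of_le_one_left dist_nonneg t.2.2

/-! ### Filling gaps at successive scales -/

/-- A family of relations `R n`, each pair in `R n` being joined by a path of size `2⁻ⁿ`
up to two gaps in `R (n + 1)`. -/
structure GapFilling (X : Type*) [MetricSpace X] where
  /-- `R n p q` says that the gap between `p` and `q` can be filled at scale `2⁻ⁿ`. -/
  R : ℕ → X → X → Prop
  dist_le : ∀ {n p q}, R n p q → dist p q ≤ (1 / 2) ^ n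
  /-- The start of the filling path. -/
  a : ∀ {n p q}, R n p q → X
  /-- The end of the filling path. -/
  b : ∀ {n p q}, R n p q → X
  left : ∀ {n p q} (h : R n p q), R (n + 1) p (a h)
  right : ∀ {n p q} (h : R n p q), R (n + 1) (b h) q
  /-- The filling path. -/
  path : ∀ {n p q} (h : R n p q), Path (a h) (b h)
  dist_path_le : ∀ {n p q} (h : R n p q) t, dist (path h t) p ≤ 2 * (1 / 2) ^ n

namespace GapFilling

variable {X : Type*} [MetricSpace X] (G : GapFilling X)
  {E : Type*} [NormedAddCommGroup E] [NormedSpace ℝ E] {ι : X → E} (hι : Isometry ι)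

/-- The `k`-th approximation to a path filling a gap, with segments across the remaining gaps. -/
noncomputable def approx : ℕ → ∀ {n : ℕ} {p q : X}, G.R n p q → Path (ι p) (ι q)
  | 0, _, p, q, _ => segmentPath (ι p) (ι q)
  | k + 1, _, _, _, h => (approx k (G.left h)).trans
      (((G.path h).map hι.continuous).trans (approx k (G.right h)))

/-- The constant `4` solves `C = 2 + C / 2`: the right-hand gap starts within `2 * 2⁻ⁿ` of `p` and
contributes at most `C * 2⁻⁽ⁿ⁺¹⁾`. -/
theorem dist_approx_le (k : ℕ) : ∀ {n : ℕ} {p q : X} (h : G.R n p q) (t : unitInterval),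
    dist (G.approx hι k h t) (ι p) ≤ 4 * (1 / 2) ^ n := by
  induction k with
  | zero =>
    intro n p q h t
    have h1 : dist (segmentPath (ι p) (ι q) t) (ι p) ≤ (1 / 2) ^ n :=
      (dist_segmentPath_le _ _ t).trans ((hι.dist_eq p q).trans_le (G.dist_le h))
    have : (0 : ℝ) < (1 / 2) ^ n := by positivity
    exact h1.trans (by linarith)
  | succ k ih =>
    intro n p q h t
    have : (0 : ℝ) < (1 / 2) ^ n := by positivity
    refine Path.forall_trans (P := fun z => dist z (ι p) ≤ 4 * (1 / 2) ^ n) (fun t => ?_)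
      (Path.forall_trans (P := fun z => dist z (ι p) ≤ 4 * (1 / 2) ^ n)
        (fun t => ?_) fun t => ?_) t
    · have := ih (G.left h) t
      rw [pow_succ] at this
      linarith
    · have := G.dist_path_le h t
      rw [← hι.dist_eq] at this
      change dist (ι (G.path h t)) (ι p) ≤ _
      linarith
    · have h1 := ih (G.right h) t
      have h2 := G.dist_path_le h 1
      rw [(G.path h).target, ← hι.dist_eq] at h2
      rw [pow_succ] at h1
      linarith [dist_triangle (G.approx hι k (G.right h) t) (ι (G.b h)) (ι p)]

/-- Successive approximations share parametrization and filling paths, hence differ only over the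
remaining gaps, which have scale `2⁻⁽ⁿ⁺ᵏ⁾`; there both are within `4` times that scale of the same
point. -/
theorem dist_approx_succ_le (k : ℕ) : ∀ {n : ℕ} {p q : X} (h : G.R n p q) (t : unitInterval),
    dist (G.approx hι k h t) (G.approx hι (k + 1) h t) ≤ 8 * (1 / 2) ^ n * (1 / 2) ^ k := by
  induction k with
  | zero =>
    intro n p q h t
    have := dist_triangle_right (G.approx hι 0 h t) (G.approx hι 1 h t) (ι p)
    have h1 := G.dist_approx_le hι 0 h t
    have h2 := G.dist_approx_le hι 1 h t
    simp only [pow_zero, mul_one, zero_add]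
    linarith
  | succ k ih =>
    intro n p q h t
    have key : (8 : ℝ) * (1 / 2) ^ n * (1 / 2) ^ (k + 1) = 8 * (1 / 2) ^ (n + 1) * (1 / 2) ^ k := by
      ring
    rw [key]
    exact Path.dist_trans_le (ih (G.left h)) (Path.dist_trans_le
      (fun t => by rw [dist_self]; positivity) (ih (G.right h))) t

/-- Only the segments across the remaining gaps leave the image of `ι`, so the limit path will lie
in its closure. -/
theorem exists_dist_approx_le (k : ℕ) : ∀ {n : ℕ} {p q : X} (h : G.R n p q) (t : unitInterval),
    ∃ x, dist (G.approx hι k h t) (ι x) ≤ 4 * (1 / 2) ^ (n + k) := by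
  induction k with
  | zero => exact fun {n p q} h t => ⟨p, G.dist_approx_le hι 0 h t⟩
  | succ k ih =>
    intro n p q h t
    rw [show n + (k + 1) = n + 1 + k by ring]
    let P : E → Prop := fun z => ∃ x, dist z (ι x) ≤ 4 * (1 / 2) ^ (n + 1 + k)
    refine Path.forall_trans (P := P) (ih (G.left h))
      (Path.forall_trans (P := P) (fun t => ⟨G.path h t, ?_⟩) (ih (G.right h))) t
    change dist (ι (G.path h t)) _ ≤ _
    rw [dist_self]
    positivity

theorem joinedIn [CompleteSpace X] {n : ℕ} {p q : X} (h : G.R n p q) :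
    JoinedIn (Metric.closedBall p (4 * (1 / 2) ^ n)) p q := by
  have : Nonempty X := ⟨p⟩
  obtain ⟨ι, hι⟩ := exists_isometry_boundedContinuousFunction X
  let f : ℕ → C(unitInterval, BoundedContinuousFunction X ℝ) :=
    fun k => (G.approx hι k h).toContinuousMap
  have hf : CauchySeq f := cauchySeq_of_le_geometric (1 / 2) (8 * (1 / 2) ^ n) (by norm_num)
    fun k => (ContinuousMap.dist_le (by positivity)).2 (G.dist_approx_succ_le hι k h)
  obtain ⟨g, hg⟩ := cauchySeq_tendsto_of_complete hf
  have hgt : ∀ t, Filter.Tendsto (fun k => G.approx hι k h t) Filter.atTop (𝓝 (g t)) := fun t =>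
    ((continuous_eval_const t).tendsto g).comp hg
  have hrange : ∀ t, ∃ x, ι x = g t := fun t => by
    -- Completeness of `X` makes the image of `ι` closed, so it is enough to approximate `g t` by
    -- points of it.
    rw [← mem_range, ← hι.isClosedEmbedding.isClosed_range.closure_eq, Metric.mem_closure_range_iff]
    intro ε hε
    have hlim : Filter.Tendsto (fun k : ℕ => (4 : ℝ) * (1 / 2) ^ (n + k) +
        dist (G.approx hι k h t) (g t)) Filter.atTop (𝓝 0) := by
      have h1 := (tendsto_pow_atTop_nhds_zero_of_lt_one (r := (1 / 2 : ℝ)) (by norm_num)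
        (by norm_num)).const_mul (4 * (1 / 2) ^ n)
      have h2 := h1.add (tendsto_iff_dist_tendsto_zero.1 (hgt t))
      simpa only [mul_zero, add_zero, pow_add, mul_assoc] using h2
    obtain ⟨k, hk⟩ := (hlim.eventually_lt_const hε).exists
    obtain ⟨x, hx⟩ := G.exists_dist_approx_le hι k h t
    refine ⟨x, lt_of_le_of_lt ?_ hk⟩
    have := dist_triangle_left (g t) (ι x) (G.approx hι k h t)
    linarith
  choose γ hγ using hrange
  have hc : Continuous γ := hι.isEmbedding.continuous_iff.2 (by
    rw [show ι ∘ γ = g from funext hγ]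
    exact g.continuous)
  refine ⟨⟨⟨γ, hc⟩, hι.injective ?_, hι.injective ?_⟩, fun t => ?_⟩
  · exact (hγ 0).trans (tendsto_nhds_unique (hgt 0) (by simp))
  · exact (hγ 1).trans (tendsto_nhds_unique (hgt 1) (by simp))
  · change dist (γ t) p ≤ _
    rw [← hι.dist_eq, hγ]
    exact le_of_tendsto ((hgt t).dist tendsto_const_nhds)
      (Filter.Eventually.of_forall fun k => G.dist_approx_le hι k h t)

end GapFilling

/-! ### Small paths near each point, and the conclusion -/

theorem ArcJoinedIn.joinedIn {X : Type*} [TopologicalSpace X] {S : Set X} {x y : X}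
    (h : ArcJoinedIn S x y) : JoinedIn S x y := by
  rcases h with ⟨rfl, hx⟩ | ⟨γ, -, hγ⟩
  · exact JoinedIn.refl hx
  · exact ⟨γ, fun t => hγ (mem_range_self t)⟩

/-- In a complete metric space that is locally almost arcwise connected, points close to a given
point are joined to it by a small path. -/
theorem LocallyAlmostArcwiseConnected.exists_forall_joinedIn {X : Type*} [MetricSpace X]
    [CompleteSpace X] (hloc : LocallyAlmostArcwiseConnected X) :
    ∃ U : ℕ → X → Set X, (∀ n x, IsOpen (U n x)) ∧ (∀ n x, x ∈ U n x) ∧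
      ∀ n x, ∀ y ∈ U n x, JoinedIn (Metric.closedBall x (4 * (1 / 2) ^ n)) x y := by
  have hex : ∀ (n : ℕ) (x : X), ∃ U : Set X, IsOpen U ∧ x ∈ U ∧ U ⊆ Metric.ball x ((1 / 2) ^ n) ∧
      ∀ A B : Set X, IsOpen A → A.Nonempty → A ⊆ U → IsOpen B → B.Nonempty → B ⊆ U →
        ∃ a ∈ A, ∃ b ∈ B, JoinedIn (Metric.closedBall x ((1 / 2) ^ n)) a b := fun n x => by
    obtain ⟨U, hU, hUV, h⟩ := hloc x (Metric.ball x ((1 / 2) ^ n))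
      (Metric.ball_mem_nhds x (by positivity))
    refine ⟨interior U, isOpen_interior, mem_interior_iff_mem_nhds.2 hU,
      interior_subset.trans hUV, fun A B hA hA' hAU hB hB' hBU => ?_⟩
    obtain ⟨a, ha, b, hb, hab⟩ := h A B hA hA' (hAU.trans interior_subset) hB hB'
      (hBU.trans interior_subset)
    exact ⟨a, ha, b, hb, hab.joinedIn.mono Metric.closure_ball_subset_closedBall⟩
  choose U hUo hxU hUb hU using hex
  -- The relation is symmetric because the new left gap is centred at its start `p` and the new
  -- right gap at its end `q`.
  let R : ℕ → X → X → Prop := fun n p q => q ∈ U n p ∨ p ∈ U n q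
  have hdist : ∀ {n p q}, R n p q → dist p q ≤ (1 / 2) ^ n := by
    rintro n p q (h | h)
    · exact (Metric.mem_ball'.1 (hUb n p h)).le
    · exact (Metric.mem_ball.1 (hUb n q h)).le
  have hstep : ∀ {n p q}, R n p q → ∃ a b, R (n + 1) p a ∧ R (n + 1) b q ∧
      ∃ γ : Path a b, ∀ t, dist (γ t) p ≤ 2 * (1 / 2) ^ n := by
    intro n p q h
    obtain ⟨c, hpc, hqc, hcp⟩ : ∃ c, p ∈ U n c ∧ q ∈ U n c ∧ dist c p ≤ (1 / 2) ^ n := by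
      rcases h with h | h
      · exact ⟨p, hxU n p, h, by rw [dist_self]; positivity⟩
      · exact ⟨q, h, hxU n q, (Metric.mem_ball'.1 (hUb n q h)).le⟩
    -- The open sets are small neighborhoods of `p` and `q`, so the gaps left over have scale
    -- `2⁻⁽ⁿ⁺¹⁾`.
    obtain ⟨a, ha, b, hb, γ, hγ⟩ := hU n c (U n c ∩ U (n + 1) p) (U n c ∩ U (n + 1) q)
      ((hUo _ _).inter (hUo _ _)) ⟨p, hpc, hxU _ _⟩ inter_subset_left
      ((hUo _ _).inter (hUo _ _)) ⟨q, hqc, hxU _ _⟩ inter_subset_left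
    refine ⟨a, b, Or.inl ha.2, Or.inr hb.2, γ, fun t => ?_⟩
    have := Metric.mem_closedBall.1 (hγ t)
    linarith [dist_triangle (γ t) c p]
  choose a b ha hb γ hγ using @hstep
  exact ⟨U, hUo, hxU, fun n x y hy => GapFilling.joinedIn
    { R := R, dist_le := hdist, a := a, b := b, left := ha, right := hb, path := γ,
      dist_path_le := hγ } (Or.inl hy)⟩

theorem mainTheorem9 (X : Type*) [TopologicalSpace X]
    [TopologicalSpace.IsCompletelyMetrizableSpace X]
    (h : AlmostArcwiseConnected X) (hloc : LocallyAlmostArcwiseConnected X) :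
    ArcwiseConnected X ∧ LocallyArcwiseConnected X := by
  let _ := TopologicalSpace.upgradeIsCompletelyMetrizable X
  obtain ⟨U, hUo, hxU, hU⟩ := hloc.exists_forall_joinedIn
  refine ⟨fun x _ y _ => ?_, fun x V hV => ?_⟩
  -- An arc between neighborhoods of `x` and `y` is extended to both points by small paths.
  · obtain ⟨a, ha, b, hb, hab⟩ := h (U 0 x) (U 0 y) (hUo 0 x) ⟨x, hxU 0 x⟩ (hUo 0 y) ⟨y, hxU 0 y⟩
    exact ((((hU 0 x a ha).mono (subset_univ _)).trans hab.joinedIn).trans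
      ((hU 0 y b hb).mono (subset_univ _)).symm).arcJoinedIn
  · have hxV : x ∈ interior V := mem_interior_iff_mem_nhds.2 hV
    refine ⟨pathComponentIn (interior V) x, ?_, mem_pathComponentIn_self hxV,
      pathComponentIn_subset.trans interior_subset, fun y hy z hz =>
        ((isPathConnected_pathComponentIn hxV).joinedIn y hy z hz).arcJoinedIn⟩
    -- The path component is open: points near `y` are joined to `y` inside a closed ball contained
    -- in `interior V`.
    refine isOpen_iff_mem_nhds.2 fun y hy => ?_
    obtain ⟨ε, hε, hεV⟩ := Metric.nhds_basis_closedBall.mem_iff.1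
      (isOpen_interior.mem_nhds (pathComponentIn_subset hy))
    obtain ⟨n, hn⟩ := exists_pow_lt_of_lt_one (show 0 < ε / 4 by positivity)
      (show (1 / 2 : ℝ) < 1 by norm_num)
    filter_upwards [(hUo n y).mem_nhds (hxU n y)] with z hz
    exact JoinedIn.trans hy ((hU n y z hz).mono
      ((Metric.closedBall_subset_closedBall (by linarith)).trans hεV))
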